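/- Conventions. $\|\cdot\|$ is the Euclidean norm on $\mathbb R^k$, and also the Euclidean norm on $\bigwedge^r(\mathbb R^{k})$ for which the $e_{i_1}\wedge\cdots\wedge e_{i_r}$ ($i_1<\dots<i_r$) are orthonormal. For a ball $B=B(x,r)\subset\mathbb R^d$ and $\lambda>0$, $\lambda B=B(x,\lambda r)$. For $\varepsilon>0$, $K_\varepsilon$ is the set of unimodular lattices $\Lambda=g\mathbb Z^{n+1}$, $g\in \mathrm{SL}_{n+1}(\mathbb R)$, with $\inf_{v\in\Lambda,\,v\ne0}\|v\|\ge\varepsilon$. A collection $v_1,\dots,v_r\in\mathbb Z^{n+1}$ ($r\ge1$) is primitive if it is linearly independent and $\mathrm{Span}_{\mathbb Z}(v_1,\dots,v_r)=\mathbb Z^{n+1}\cap \mathrm{Span}_{\mathbb R}(v_1,\dots,v_r)$. Let $\mu$ be a locally finite Borel measure on $\mathbb R^d$ and $U\subset\mathbb R^d$ open. The measure $\mu$ is $D$-Federer on $U$ if $\mu(B(x,3r))<D\,\mu(B(x,r))$ for all $x\in U\cap\operatorname{supp}\mu$ and all $r>0$ with $B(x,3r)\subset U$. A $\mu$-measurable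 function $f:U\to\mathbb R$ is absolutely $(C,\alpha)$-good on $U$ w.r.t. $\mu$ if for every non-empty open ball $B\subset U$ centred in $\operatorname{supp}\mu$ and every $\varepsilon>0$, $$\mu(\{x\in B:|f(x)|<\varepsilon\})\le C\left(\frac{\varepsilon}{\|f\|_B}\right)^{\alpha}\mu(B),\qquad \|f\|_B:=\sup_{x\in B}|f(x)|$$ (with $\varepsilon/0=\infty$ and $\varepsilon/\infty=0$). **Theorem.** Let $n,d\ge1$ be integers and $C,D,\alpha>0$. Then there exists a positive constant $C''=C''(n,d,C,D,\alpha)$ with the following property. Suppose that $0<\rho\le1$, $\mu$ is a locally finite Borel measure on $\mathbb R^d$ and $B$ is a non-empty open ball in $\mathbb R^d$ centred in $\operatorname{supp}\mu$. Suppose that $\mu$ is $D$-Federer on $\tilde B=3^{n+1}B$ and that $h:\tilde B\to \mathrm{SL}_{n+1}(\mathbb R)$ is a continuous map such that for any primitive collection $v_1,\dots,v_r\in\mathbb Z^{n+1}$ (i*) the function $x\mapsto\|h(x)v_1\wedge\cdots\wedge h(x)v_r\|$ is absolutely $(C,\alpha)$-good on $\tilde B$ w.r.t. $\mu$; and (ii*)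 $\sup_{x\in B}\|h(x)v_1\wedge\cdots\wedge h(x)v_r\|\ge\rho$. Then for any $\varepsilon>0$ $$\mu\left(\{x\in B: h(x)\mathbb Z^{n+1}\notin K_\varepsilon\}\right)\le C''\left(\frac{\varepsilon}{\rho}\right)^{\alpha}\mu(B).$$ -/

import Mathlib

open MeasureTheory
open scoped ENNReal

namespace QuantNonDiv

/-! ### Lattices and multivectors in Euclidean space -/

/-- The inclusion of `ℤ^k` into the Euclidean space `ℝ^k`. -/
noncomputable def intEmb (k : ℕ) : (Fin k → ℤ) →ₗ[ℤ] EuclideanSpace ℝ (Fin k) where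
  toFun m := WithLp.toLp 2 (fun i => (m i : ℝ))
  map_add' a b := by
    ext i
    simp
  map_smul' c a := by
    ext i
    simp

/-- The integer lattice `ℤ^k`, as a subgroup of `ℝ^k`. -/
noncomputable def intLattice (k : ℕ) : Submodule ℤ (EuclideanSpace ℝ (Fin k)) :=
  LinearMap.range (intEmb k)

/-- The action `v ↦ g v` of a matrix on column vectors. -/
noncomputable def act {k : ℕ} (g : Matrix.SpecialLinearGroup (Fin k) ℝ) :
    EuclideanSpace ℝ (Fin k) →ₗ[ℝ] EuclideanSpace ℝ (Fin k) :=
  Matrix.toEuclideanLin (g : Matrix (Fin k) (Fin k) ℝ)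

/-- The unimodular lattice `g ℤ^k`. -/
noncomputable def latticeOf {k : ℕ} (g : Matrix.SpecialLinearGroup (Fin k) ℝ) :
    Submodule ℤ (EuclideanSpace ℝ (Fin k)) :=
  (intLattice k).map ((act g).restrictScalars ℤ)

/-- The space of unimodular lattices in `ℝ^k`: all lattices `g ℤ^k` with `g ∈ SL_k(ℝ)`. -/
def unimodularLattices (k : ℕ) : Set (Submodule ℤ (EuclideanSpace ℝ (Fin k))) :=
  Set.range latticeOf

/-- The set `K_ε` of unimodular lattices whose nonzero vectors have infimal norm at least `ε`. -/
def latticesK (k : ℕ) (ε : ℝ) : Set (Submodule ℤ (EuclideanSpace ℝ (Fin k))) :=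
  {Λ | Λ ∈ unimodularLattices k ∧ ε ≤ sInf ((fun v => ‖v‖) '' {v | v ∈ Λ ∧ v ≠ 0})}

/-- A collection `v₁, …, v_r ∈ ℤ^k` is primitive if it is linearly independent and its integer
span is the intersection of `ℤ^k` with its real span. -/
def IsPrimitiveCollection {k r : ℕ} (v : Fin r → Fin k → ℤ) : Prop :=
  LinearIndependent ℝ (fun i => intEmb k (v i)) ∧
    Submodule.span ℤ (Set.range fun i => intEmb k (v i)) =
      intLattice k ⊓
        (Submodule.span ℝ (Set.range fun i => intEmb k (v i))).restrictScalars ℤ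

/-- `‖g v₁ ∧ ⋯ ∧ g v_r‖`, with the Euclidean norm on the `r`-th exterior power of `ℝ^k` for which
the wedge products of standard basis vectors are orthonormal. -/
noncomputable def wedgeNorm {k r : ℕ} (g : Matrix.SpecialLinearGroup (Fin k) ℝ)
    (v : Fin r → Fin k → ℤ) : ℝ :=
  ‖exteriorPower.ιMulti ℝ r (fun i => act g (intEmb k (v i)))‖

/-! ### Federer measures and absolutely good functions -/

/-- `μ` is `D`-Federer on `U`. -/
def IsFederer {d : ℕ} (D : ℝ) (μ : Measure (EuclideanSpace ℝ (Fin d)))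
    (U : Set (EuclideanSpace ℝ (Fin d))) : Prop :=
  ∀ x ∈ μ.support ∩ U, ∀ r : ℝ, 0 < r → Metric.ball x (3 * r) ⊆ U →
    μ (Metric.ball x (3 * r)) < ENNReal.ofReal D * μ (Metric.ball x r)

/-- `‖f‖_S = sup_{x ∈ S} |f x|`, as an element of `[0, ∞]`. -/
noncomputable def supNormOn {d : ℕ} (f : EuclideanSpace ℝ (Fin d) → ℝ)
    (S : Set (EuclideanSpace ℝ (Fin d))) : ℝ≥0∞ :=
  ⨆ x ∈ S, ENNReal.ofReal |f x|

/-- `f` is absolutely `(C, α)`-good on `U` with respect to `μ`. The inequality is one in `[0, ∞]`: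
for `‖f‖_B = 0` it is void, and for `‖f‖_B = ∞` its right-hand side is `0`. -/
def IsAbsGood {d : ℕ} (C α : ℝ) (μ : Measure (EuclideanSpace ℝ (Fin d)))
    (U : Set (EuclideanSpace ℝ (Fin d))) (f : EuclideanSpace ℝ (Fin d) → ℝ) : Prop :=
  AEMeasurable f (μ.restrict U) ∧
    ∀ x ∈ μ.support, ∀ r : ℝ, 0 < r → Metric.ball x r ⊆ U → ∀ ε : ℝ, 0 < ε →
      μ {y ∈ Metric.ball x r | |f y| < ε} ≤
        ENNReal.ofReal C * (ENNReal.ofReal ε / supNormOn f (Metric.ball x r)) ^ α *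
          μ (Metric.ball x r)

end QuantNonDiv

/-! This is the Kleinbock–Margulis argument with flags of primitive subgroups of `ℤ^k`, `k = n + 1`.
To each such subgroup attach `ψ`, the covolume of its image under `h x`. A point is marked if some
flag of subgroups has all its `ψ`-values in `[ε, ρ]`, while every subgroup that could refine the
flag has `ψ ≥ ρ`.

At a marked point no nonzero lattice vector is shorter than `ε` (`le_norm_of_isMarked`). Given an
integer vector `w`, adjoin it to the largest flag member avoiding it. The covolume grows by at most
the factor `‖h(x) w‖`, and it ends up at least `ε`, since the new span either occurs in the flag or
refines it.

Unmarked points are rare (`measure_not_isMarked_le`), by induction on the number of ranks still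
available. Around an unmarked point, stop at a radius where all refining `ψ` reach `ρ` but one stays
below `ρ` on a third of the ball (`exists_radius`), and add that subgroup to the flag. The points
lost have `ψ < ε`, which goodness controls. The local bounds are summed by a Vitali covering and the
Federer property (`IsFederer.measure_le_of_local`). -/

namespace QuantNonDiv

/-! ### Norms of decomposable multivectors -/

/-- The Gram determinant under an integral change of vectors. -/
theorem gram_det_of_int_comb {E : Type*} [NormedAddCommGroup E] [InnerProductSpace ℝ E] {r : ℕ}
    (u v : Fin r → E) (A : Matrix (Fin r) (Fin r) ℤ)
    (h : ∀ i, v i = ∑ j, (A i j : ℝ) • u j) :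
    (Matrix.gram ℝ v).det = (A.det : ℝ) ^ 2 * (Matrix.gram ℝ u).det := by
  have hA : ((A.map ((↑) : ℤ → ℝ)).det) = (A.det : ℝ) :=
    (Int.cast_det A).symm
  have : Matrix.gram ℝ v =
      A.map ((↑) : ℤ → ℝ) * Matrix.gram ℝ u * (A.map ((↑) : ℤ → ℝ)).transpose := by
    ext i j
    simp only [Matrix.gram_apply, h, Matrix.mul_apply, Matrix.map_apply, Matrix.transpose_apply,
      sum_inner, inner_sum, real_inner_smul_left, real_inner_smul_right, Finset.sum_mul]
    refine Finset.sum_congr rfl fun a _ => Finset.sum_congr rfl fun b _ => by ring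
  rw [this, Matrix.det_mul, Matrix.det_mul, Matrix.det_transpose, hA]
  ring

section Multivectors

variable {E : Type*} [NormedAddCommGroup E] [InnerProductSpace ℝ E] [FiniteDimensional ℝ E]

theorem norm_ιMulti_sq {r : ℕ} (v : Fin r → E) :
    ‖exteriorPower.ιMulti ℝ r v‖ ^ 2 = (Matrix.gram ℝ v).det := by
  rw [← exteriorPower.inner_ιMulti_self, real_inner_self_eq_norm_sq]

theorem norm_ιMulti_eq_sqrt {r : ℕ} (v : Fin r → E) :
    ‖exteriorPower.ιMulti ℝ r v‖ = √(Matrix.gram ℝ v).det := by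
  rw [← norm_ιMulti_sq, Real.sqrt_sq (norm_nonneg _)]

theorem norm_ιMulti_zero (v : Fin 0 → E) : ‖exteriorPower.ιMulti ℝ 0 v‖ = 1 := by
  simp [norm_ιMulti_eq_sqrt]

/-- Adjoining a vector orthogonal to the others multiplies the norm of the multivector. -/
theorem norm_ιMulti_cons_of_orthogonal {r : ℕ} (w : E) (v : Fin r → E)
    (h : ∀ i, inner ℝ w (v i) = 0) :
    ‖exteriorPower.ιMulti ℝ (r + 1) (Matrix.vecCons w v)‖ =
      ‖w‖ * ‖exteriorPower.ιMulti ℝ r v‖ := by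
  have key : (Matrix.gram ℝ (Matrix.vecCons w v)).det = ‖w‖ ^ 2 * (Matrix.gram ℝ v).det := by
    rw [Matrix.det_succ_row_zero, Finset.sum_eq_single 0]
    · simp only [Matrix.gram_apply, Matrix.cons_val_zero, real_inner_self_eq_norm_sq,
        Fin.val_zero, pow_zero, one_mul]
      congr 2
    · intro j _ hj
      obtain ⟨i, rfl⟩ := Fin.exists_succ_eq.2 hj
      simp [h]
    · simp
  rw [norm_ιMulti_eq_sqrt, norm_ιMulti_eq_sqrt, key, Real.sqrt_mul (sq_nonneg _),
    Real.sqrt_sq (norm_nonneg _)]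

/-- Fischer's inequality for adjoining one vector. -/
theorem norm_ιMulti_cons_le {r : ℕ} (w : E) (v : Fin r → E) :
    ‖exteriorPower.ιMulti ℝ (r + 1) (Matrix.vecCons w v)‖ ≤
      ‖w‖ * ‖exteriorPower.ιMulti ℝ r v‖ := by
  set W := Submodule.span ℝ (Set.range v) with hW
  -- The component `p` in the span of `v` dies in the wedge product, and the orthogonal component
  -- `q` is no longer than `w`.
  obtain ⟨p, hp, q, hq, rfl⟩ := W.exists_add_mem_mem_orthogonal w
  have hq' : ∀ i, inner ℝ q (v i) = 0 := fun i =>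
    (Submodule.mem_orthogonal' W q).1 hq _ (Submodule.subset_span ⟨i, rfl⟩)
  have hpq : inner ℝ p q = 0 := (Submodule.mem_orthogonal W q).1 hq p hp
  have hdep : exteriorPower.ιMulti ℝ (r + 1) (Matrix.vecCons p v) = 0 := by
    apply AlternatingMap.map_linearDependent
    intro hli
    exact (linearIndependent_finCons.1 hli).2 hp
  have hadd : exteriorPower.ιMulti ℝ (r + 1) (Matrix.vecCons (p + q) v) =
      exteriorPower.ιMulti ℝ (r + 1) (Matrix.vecCons q v) := by
    rw [AlternatingMap.map_vecCons_add, hdep, zero_add]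
  rw [hadd, norm_ιMulti_cons_of_orthogonal q v hq']
  gcongr
  have := norm_add_sq_eq_norm_sq_add_norm_sq_of_inner_eq_zero p q hpq
  exact (sq_le_sq₀ (norm_nonneg _) (norm_nonneg _)).1 (by nlinarith [norm_nonneg p])

/-- A nonzero integer has square at least `1`: passing to a finite-index sublattice cannot decrease
the covolume. -/
theorem norm_ιMulti_le_of_int_comb {r : ℕ} (u v : Fin r → E) (A : Matrix (Fin r) (Fin r) ℤ)
    (h : ∀ i, v i = ∑ j, (A i j : ℝ) • u j) (hA : A.det ≠ 0) :
    ‖exteriorPower.ιMulti ℝ r u‖ ≤ ‖exteriorPower.ιMulti ℝ r v‖ := by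
  have h1 : (1 : ℝ) ≤ (A.det : ℝ) ^ 2 := by
    have : 1 ≤ A.det ^ 2 := Int.add_one_le_iff.2 (sq_pos_of_ne_zero hA)
    exact_mod_cast this
  have h2 := gram_det_of_int_comb u v A h
  rw [← norm_ιMulti_sq, ← norm_ιMulti_sq] at h2
  refine (sq_le_sq₀ (norm_nonneg _) (norm_nonneg _)).1 ?_
  rw [h2]
  exact le_mul_of_one_le_left (sq_nonneg _) h1

end Multivectors

/-! ### Primitive collections -/

theorem intEmb_injective (k : ℕ) : Function.Injective (intEmb k) := by
  intro a b h
  funext i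
  have := congrArg (fun z : EuclideanSpace ℝ (Fin k) => z i) h
  simpa [intEmb] using this

theorem linearIndependent_intEmb {k : ℕ} {ι : Type*} {v : ι → Fin k → ℤ}
    (h : LinearIndependent ℤ v) : LinearIndependent ℝ (fun i => intEmb k (v i)) := by
  have h1 : LinearIndependent ℝ (fun i => (fun j => algebraMap ℤ ℝ (v i j))) :=
    (linearIndependent_algebraMap_comp_iff (S := ℝ)).2 h
  exact h1.map' (WithLp.linearEquiv 2 ℝ (Fin k → ℝ)).symm.toLinearMap
    (LinearMap.ker_eq_bot.2 (LinearEquiv.injective _))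

/-- The real span of a collection of integer vectors. -/
noncomputable def realSpan {k r : ℕ} (v : Fin r → Fin k → ℤ) :
    Submodule ℝ (EuclideanSpace ℝ (Fin k)) :=
  Submodule.span ℝ (Set.range fun i => intEmb k (v i))

theorem IsPrimitiveCollection.finrank_realSpan {k r : ℕ} {v : Fin r → Fin k → ℤ}
    (hv : IsPrimitiveCollection v) : Module.finrank ℝ (realSpan v) = r :=
  (finrank_span_eq_card hv.1).trans (Fintype.card_fin r)

theorem IsPrimitiveCollection.le {k r : ℕ} {v : Fin r → Fin k → ℤ}
    (hv : IsPrimitiveCollection v) : r ≤ k := by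
  simpa [hv.finrank_realSpan] using (realSpan v).finrank_le

/-- Every real subspace spanned by integer vectors is the span of a primitive collection. -/
theorem exists_primitive_of_span {k : ℕ} (S : Set (Fin k → ℤ)) :
    ∃ (r : ℕ) (u : Fin r → Fin k → ℤ), IsPrimitiveCollection u ∧
      realSpan u = Submodule.span ℝ (intEmb k '' S) := by
  set W := Submodule.span ℝ (intEmb k '' S) with hW
  -- All integer points of `W` form a free `ℤ`-module, any basis of which is primitive; it spans `W`
  -- because it contains `S`.
  let Δ : Submodule ℤ (Fin k → ℤ) := (W.restrictScalars ℤ).comap (intEmb k)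
  let b := Module.finBasis ℤ Δ
  let u : Fin (Module.finrank ℤ Δ) → Fin k → ℤ := fun i => (b i : Fin k → ℤ)
  have hli : LinearIndependent ℤ u :=
    b.linearIndependent.map' Δ.subtype (Submodule.ker_subtype _)
  have hspan : Submodule.span ℤ (Set.range u) = Δ := by
    have : Set.range u = Δ.subtype '' Set.range b := by
      rw [← Set.range_comp]; rfl
    rw [this, Submodule.span_image, b.span_eq, Submodule.map_top, Submodule.range_subtype]
  have hspan' : Submodule.span ℤ (Set.range fun i => intEmb k (u i)) = Δ.map (intEmb k) := by
    refine Eq.trans ?_ (congrArg (Submodule.map (intEmb k)) hspan)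
    rw [← Submodule.span_image, ← Set.range_comp]; rfl
  have hW' : realSpan u = W := by
    apply le_antisymm
    · rw [realSpan, Submodule.span_le]
      rintro _ ⟨i, rfl⟩
      exact (b i).2
    · rw [hW, Submodule.span_le]
      rintro _ ⟨s, hs, rfl⟩
      have h1 : intEmb k s ∈ Δ.map (intEmb k) :=
        Submodule.mem_map_of_mem (show intEmb k s ∈ W from Submodule.subset_span ⟨s, hs, rfl⟩)
      rw [← hspan'] at h1
      exact Submodule.span_le_restrictScalars ℤ ℝ _ h1
  refine ⟨_, u, ⟨linearIndependent_intEmb hli, ?_⟩, hW'⟩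
  rw [hspan', show Submodule.span ℝ (Set.range fun i => intEmb k (u i)) = W from hW',
    Submodule.map_comap_eq]
  rfl

/-! ### Covolumes of primitive collections -/

theorem wedgeNorm_nonneg {k r : ℕ} (g : Matrix.SpecialLinearGroup (Fin k) ℝ)
    (v : Fin r → Fin k → ℤ) : 0 ≤ wedgeNorm g v := norm_nonneg _

/-- If `u` and `v` are primitive and the span of `u` is that of `v` and one more integer
vector `w`, then the covolume of `u` is at most that of `v` times the length of `w`. -/
theorem wedgeNorm_le_mul {k r m : ℕ} (g : Matrix.SpecialLinearGroup (Fin k) ℝ)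
    {v : Fin r → Fin k → ℤ} {u : Fin m → Fin k → ℤ} (w : Fin k → ℤ)
    (hv : LinearIndependent ℝ fun i => intEmb k (v i)) (hu : IsPrimitiveCollection u)
    (hw : intEmb k w ∉ realSpan v)
    (hspan : realSpan u = realSpan v ⊔ Submodule.span ℝ {intEmb k w}) :
    wedgeNorm g u ≤ ‖act g (intEmb k w)‖ * wedgeNorm g v := by
  let x : Fin (r + 1) → EuclideanSpace ℝ (Fin k) :=
    Matrix.vecCons (intEmb k w) fun i => intEmb k (v i)
  have hx : LinearIndependent ℝ x := linearIndependent_finCons.2 ⟨hv, hw⟩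
  have hxspan : Submodule.span ℝ (Set.range x) = realSpan u := by
    rw [hspan, sup_comm, Matrix.range_cons, Submodule.span_union]; rfl
  have hm : r + 1 = m := by
    rw [← hu.finrank_realSpan, ← hxspan, finrank_span_eq_card hx, Fintype.card_fin]
  subst hm
  have hmem : ∀ i, x i ∈ Submodule.span ℤ (Set.range fun j => intEmb k (u j)) := by
    intro i
    rw [hu.2]
    refine ⟨?_, ?_⟩
    · refine Fin.cases ⟨w, rfl⟩ (fun j => ⟨v j, rfl⟩) i
    · change x i ∈ realSpan u
      rw [← hxspan]
      exact Submodule.subset_span ⟨i, rfl⟩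
  -- `w` and `v` generate a sublattice of the primitive lattice of `u`; `A` is the transition
  -- matrix, and `|det A|` is the index.
  choose A hA using fun i => (Submodule.mem_span_range_iff_exists_fun ℤ).1 (hmem i)
  have hA' : ∀ i, x i = ∑ j, ((Matrix.of A) i j : ℝ) • intEmb k (u j) := by
    intro i
    rw [← hA i]
    refine Finset.sum_congr rfl fun j _ => ?_
    rw [Matrix.of_apply, Int.cast_smul_eq_zsmul]
  have hdet : (Matrix.of A).det ≠ 0 := by
    intro h0
    have h1 := gram_det_of_int_comb _ _ _ hA'
    rw [h0] at h1
    exact Matrix.det_gram_ne_zero_iff_linearIndependent.2 hx (by simpa using h1)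
  have hgx : (fun i => act g (x i)) =
      Matrix.vecCons (act g (intEmb k w)) fun i => act g (intEmb k (v i)) := by
    funext i
    refine Fin.cases rfl (fun j => rfl) i
  calc wedgeNorm g u ≤ ‖exteriorPower.ιMulti ℝ (r + 1) fun i => act g (x i)‖ :=
        norm_ιMulti_le_of_int_comb _ _ (Matrix.of A)
          (fun i => by rw [hA' i, map_sum]; simp only [map_smul]) hdet
    _ ≤ _ := by
        rw [hgx]
        exact norm_ιMulti_cons_le _ _

theorem continuous_wedgeNorm {k r : ℕ} (v : Fin r → Fin k → ℤ) :
    Continuous fun g : Matrix.SpecialLinearGroup (Fin k) ℝ => wedgeNorm g v := by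
  have hact : ∀ z : EuclideanSpace ℝ (Fin k),
      Continuous fun g : Matrix.SpecialLinearGroup (Fin k) ℝ => act g z := by
    intro z
    have h : Continuous fun g : Matrix.SpecialLinearGroup (Fin k) ℝ =>
        (g : Matrix (Fin k) (Fin k) ℝ).mulVec z.ofLp :=
      continuous_subtype_val.matrix_mulVec continuous_const
    exact (PiLp.continuous_toLp 2 _).comp h
  simp only [wedgeNorm, norm_ιMulti_eq_sqrt]
  refine Real.continuous_sqrt.comp (Continuous.matrix_det ?_)
  refine continuous_matrix fun i j => ?_
  simp only [Matrix.gram_apply]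
  exact (hact _).inner (hact _)

/-! ### A covering estimate for Federer measures -/

theorem IsFederer.measure_ball_le {d : ℕ} {D : ℝ} {μ : Measure (EuclideanSpace ℝ (Fin d))}
    {U : Set (EuclideanSpace ℝ (Fin d))} (h : IsFederer D μ U) {x : EuclideanSpace ℝ (Fin d)}
    (hx : x ∈ μ.support) {r : ℝ} (hr : 0 < r) (hU : Metric.ball x r ⊆ U) :
    μ (Metric.ball x r) ≤ ENNReal.ofReal D * μ (Metric.ball x (r / 3)) := by
  have h3 : 3 * (r / 3) = r := by ring
  have := h x ⟨hx, hU (Metric.mem_ball_self hr)⟩ (r / 3) (by positivity) (by rwa [h3])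
  rw [h3] at this
  exact this.le

/-- Vitali covering: three Federer steps shrink each ball from radius `t` to `t / 27`, the small
balls are disjoint inside `B(x, 3r)` because `t ≤ 2r`, and a fourth step returns to `B(x, r)`. Hence
`D ^ 4`. -/
theorem IsFederer.measure_le_of_local {d : ℕ} {D : ℝ}
    {μ : Measure (EuclideanSpace ℝ (Fin d))}
    {U : Set (EuclideanSpace ℝ (Fin d))} (h : IsFederer D μ U) {x : EuclideanSpace ℝ (Fin d)}
    (hx : x ∈ μ.support) {r : ℝ} (hr : 0 < r) (hU : Metric.ball x (3 * r) ⊆ U)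
    {S : Set (EuclideanSpace ℝ (Fin d))} (hS : S ⊆ Metric.ball x r) (hS' : S ⊆ μ.support)
    (t : EuclideanSpace ℝ (Fin d) → ℝ) (ht : ∀ y ∈ S, 0 < t y) (ht' : ∀ y ∈ S, t y ≤ 2 * r)
    (K : ℝ≥0∞)
    (hK : ∀ y ∈ S, μ (S ∩ Metric.ball y (t y / 3)) ≤ K * μ (Metric.ball y (t y))) :
    μ S ≤ K * ENNReal.ofReal D ^ 4 * μ (Metric.ball x r) := by
  have hsub : ∀ y ∈ S, Metric.ball y (t y) ⊆ Metric.ball x (3 * r) := fun y hy =>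
    Metric.ball_subset_ball' (by
      have := Metric.mem_ball.1 (hS hy)
      linarith [ht' y hy])
  -- The divisor `27` is the least power of `3` for which the fivefold enlargement still fits: `5 /
  -- 27 < 1 / 3`.
  obtain ⟨u, huS, hdisj, hcov⟩ := Vitali.exists_disjoint_subfamily_covering_enlargement_closedBall
    S (fun y => y) (fun y => t y / 27) (2 * r) (fun y hy => by
      have := ht y hy; have := ht' y hy; linarith) 5 (by norm_num)
  have hucount : u.Countable := by
    refine hdisj.countable_of_nonempty_interior fun y hy => ?_
    have := ht y (huS hy)
    exact ⟨y, Metric.ball_subset_interior_closedBall (Metric.mem_ball_self (by positivity))⟩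
  have hcover : S ⊆ ⋃ b ∈ u, S ∩ Metric.ball b (t b / 3) := by
    intro y hy
    obtain ⟨b, hb, hyb⟩ := hcov y hy
    refine Set.mem_iUnion₂.2 ⟨b, hb, hy, ?_⟩
    have hty := ht y hy
    have htb := ht b (huS hb)
    have := Metric.mem_closedBall.1 (hyb (Metric.mem_closedBall_self (by positivity)))
    exact Metric.mem_ball.2 (by linarith)
  have hsmall : ∀ b ∈ u, μ (Metric.ball b (t b)) ≤
      ENNReal.ofReal D ^ 3 * μ (Metric.ball b (t b / 27)) := by
    intro b hb
    have htb := ht b (huS hb)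
    have hsupp := hS' (huS hb)
    have hbU := (hsub b (huS hb)).trans hU
    have h1 := h.measure_ball_le hsupp htb hbU
    have h2 := h.measure_ball_le hsupp (r := t b / 3) (by positivity)
      ((Metric.ball_subset_ball (by linarith)).trans hbU)
    have h3 := h.measure_ball_le hsupp (r := t b / 3 / 3) (by positivity)
      ((Metric.ball_subset_ball (by linarith)).trans hbU)
    rw [show t b / 3 / 3 / 3 = t b / 27 by ring] at h3
    calc μ (Metric.ball b (t b)) ≤ _ := h1
      _ ≤ ENNReal.ofReal D * (ENNReal.ofReal D *
            (ENNReal.ofReal D * μ (Metric.ball b (t b / 27)))) := by gcongr; exact h2.trans (by gcongr)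
      _ = _ := by ring
  have hdisj' : u.PairwiseDisjoint fun b => Metric.ball b (t b / 27) :=
    hdisj.mono fun b => Metric.ball_subset_closedBall
  calc μ S ≤ μ (⋃ b ∈ u, S ∩ Metric.ball b (t b / 3)) := measure_mono hcover
    _ ≤ ∑' b : u, μ (S ∩ Metric.ball (b : EuclideanSpace ℝ (Fin d)) (t b / 3)) :=
        measure_biUnion_le μ hucount _
    _ ≤ ∑' b : u, K * ENNReal.ofReal D ^ 3 *
          μ (Metric.ball (b : EuclideanSpace ℝ (Fin d)) (t b / 27)) := by
        refine ENNReal.tsum_le_tsum fun b => ?_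
        refine (hK b (huS b.2)).trans ?_
        rw [mul_assoc]
        gcongr
        exact hsmall b b.2
    _ = K * ENNReal.ofReal D ^ 3 * μ (⋃ b ∈ u, Metric.ball b (t b / 27)) := by
        rw [ENNReal.tsum_mul_left, measure_biUnion hucount hdisj' fun b _ => measurableSet_ball]
    _ ≤ K * ENNReal.ofReal D ^ 3 * μ (Metric.ball x (3 * r)) := by
        gcongr
        refine Set.iUnion₂_subset fun b hb => ?_
        have htb := ht b (huS hb)
        exact (Metric.ball_subset_ball (by linarith)).trans (hsub b (huS hb))
    _ ≤ K * ENNReal.ofReal D ^ 3 * (ENNReal.ofReal D * μ (Metric.ball x r)) := by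
        gcongr
        have := h.measure_ball_le hx (r := 3 * r) (by positivity) hU
        rwa [show 3 * r / 3 = r by ring] at this
    _ = _ := by ring

/-! ### Choice of radii -/

theorem supNormOn_mono {d : ℕ} (f : EuclideanSpace ℝ (Fin d) → ℝ)
    {S T : Set (EuclideanSpace ℝ (Fin d))} (h : S ⊆ T) : supNormOn f S ≤ supNormOn f T :=
  biSup_mono fun _ hx => h hx

theorem abs_lt_of_supNormOn_lt {d : ℕ} {f : EuclideanSpace ℝ (Fin d) → ℝ}
    {S : Set (EuclideanSpace ℝ (Fin d))} {ρ : ℝ} (h : supNormOn f S < ENNReal.ofReal ρ)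
    {x : EuclideanSpace ℝ (Fin d)} (hx : x ∈ S) : |f x| < ρ :=
  (ENNReal.ofReal_lt_ofReal_iff').1
    ((le_iSup₂ (f := fun y (_ : y ∈ S) => ENNReal.ofReal |f y|) x hx).trans_lt h) |>.1

theorem exists_supNormOn_ball_lt {d : ℕ} {f : EuclideanSpace ℝ (Fin d) → ℝ}
    {x : EuclideanSpace ℝ (Fin d)} (hf : ContinuousAt f x) {ρ : ℝ} (h : |f x| < ρ) :
    ∃ t : ℝ, 0 < t ∧ supNormOn f (Metric.ball x t) < ENNReal.ofReal ρ := by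
  obtain ⟨σ, h1, h2⟩ := exists_between h
  obtain ⟨t, ht, hball⟩ := Metric.eventually_nhds_iff_ball.1 (hf.abs.eventually_lt_const h1)
  refine ⟨t, ht, lt_of_le_of_lt (iSup₂_le fun y hy => ?_)
    ((ENNReal.ofReal_lt_ofReal_iff ((abs_nonneg _).trans_lt h)).2 h2)⟩
  exact ENNReal.ofReal_le_ofReal (hball y hy).le

/-- Among functions that are large somewhere on a ball but not all large at its point `x`, there
is a radius on which all are large while one of them is small on a third of that radius. -/
theorem exists_radius {d : ℕ} {P : Type*} (ψ : P → EuclideanSpace ℝ (Fin d) → ℝ) {ρ : ℝ}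
    {x₀ x : EuclideanSpace ℝ (Fin d)} {r₀ : ℝ} (hx : x ∈ Metric.ball x₀ r₀) (T : Set P)
    (hT : ∀ s ∈ T, ENNReal.ofReal ρ ≤ supNormOn (ψ s) (Metric.ball x₀ r₀))
    (hsmall : ∃ s ∈ T, |ψ s x| < ρ ∧ ContinuousAt (ψ s) x) :
    ∃ t : ℝ, 0 < t ∧ t ≤ 2 * r₀ ∧
      (∃ s ∈ T, supNormOn (ψ s) (Metric.ball x (t / 3)) < ENNReal.ofReal ρ) ∧
      ∀ s ∈ T, ENNReal.ofReal ρ ≤ supNormOn (ψ s) (Metric.ball x t) := by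
  have hr₀ : 0 < r₀ := Metric.pos_of_mem_ball hx
  have hlarge : ∀ t, 2 * r₀ ≤ t → ∀ s ∈ T,
      ENNReal.ofReal ρ ≤ supNormOn (ψ s) (Metric.ball x t) := fun t ht s hs =>
    (hT s hs).trans (supNormOn_mono _ (Metric.ball_subset_ball' (by
      have := Metric.mem_ball'.1 hx
      linarith)))
  set R : Set ℝ := {t | 0 < t ∧ ∃ s ∈ T, supNormOn (ψ s) (Metric.ball x t) < ENNReal.ofReal ρ}
  have hne : R.Nonempty := by
    obtain ⟨s, hs, h1, h2⟩ := hsmall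
    obtain ⟨t, ht, h⟩ := exists_supNormOn_ball_lt h2 h1
    exact ⟨t, ht, s, hs, h⟩
  have hbdd : BddAbove R := by
    refine ⟨2 * r₀, fun t ⟨_, s, hs, h⟩ => ?_⟩
    by_contra hlt
    exact (hlarge t (not_le.1 hlt).le s hs).not_gt h
  obtain ⟨t₁, ht₁⟩ := hne
  have hpos : 0 < sSup R := ht₁.1.trans_le (le_csSup hbdd ht₁)
  -- A bad radius `t` above half the supremum makes `3 * t` good; capping at `2 * r₀` keeps it good,
  -- as that ball contains the original one.
  obtain ⟨t, ⟨ht, s, hs, h⟩, hlt⟩ := exists_lt_of_lt_csSup ⟨t₁, ht₁⟩ (half_lt_self hpos)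
  refine ⟨min (3 * t) (2 * r₀), by positivity, min_le_right _ _, ⟨s, hs, ?_⟩, fun s' hs' => ?_⟩
  · refine (supNormOn_mono _ (Metric.ball_subset_ball ?_)).trans_lt h
    linarith [min_le_left (3 * t) (2 * r₀)]
  · rcases le_total (3 * t) (2 * r₀) with h3 | h3
    · rw [min_eq_left h3]
      by_contra hcon
      have : 3 * t ≤ sSup R := le_csSup hbdd ⟨by positivity, s', hs', not_le.1 hcon⟩
      linarith
    · rw [min_eq_right h3]
      exact hlarge _ le_rfl s' hs'

/-! ### Marked points -/

/-- The elements strictly comparable with every element of `F`. -/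
def transversal {P : Type*} [Preorder P] (F : Set P) : Set P :=
  {s | ∀ t ∈ F, s < t ∨ t < s}

/-- The point `x` is marked relative to the flag `F` if `F` extends to a flag `G` whose new
members have `ε ≤ ψ s x ≤ ρ`, while `ψ s x ≥ ρ` for all `s` transversal to `G`. -/
def IsMarked {P X : Type*} [Preorder P] (ψ : P → X → ℝ) (ε ρ : ℝ) (F : Set P) (x : X) : Prop :=
  ∃ G : Set P, F ⊆ G ∧ IsChain (· < ·) G ∧ (∀ s ∈ G \ F, ε ≤ ψ s x ∧ ψ s x ≤ ρ) ∧
    ∀ s ∈ transversal G, ρ ≤ ψ s x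

theorem transversal_anti {P : Type*} [Preorder P] {F G : Set P} (h : F ⊆ G) :
    transversal G ⊆ transversal F := fun _ hs t ht => hs t (h ht)

theorem IsMarked.of_insert {P X : Type*} [Preorder P] {ψ : P → X → ℝ} {ε ρ : ℝ} {F : Set P}
    {x : X} {s : P} (h : IsMarked ψ ε ρ (insert s F) x) (h1 : ε ≤ ψ s x) (h2 : ψ s x ≤ ρ) :
    IsMarked ψ ε ρ F x := by
  obtain ⟨G, hFG, hG, hm, ht⟩ := h
  refine ⟨G, (Set.subset_insert _ _).trans hFG, hG, fun s' hs' => ?_, ht⟩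
  by_cases he : s' = s
  · exact he ▸ ⟨h1, h2⟩
  · exact hm s' ⟨hs'.1, fun hins => hins.elim he hs'.2⟩

/-- The constants of the inductive estimate for unmarked points. -/
noncomputable def markedConst (C D : ℝ) : ℕ → ℝ≥0∞
  | 0 => 0
  | j + 1 => (markedConst C D j + ENNReal.ofReal C) * ENNReal.ofReal D ^ 4

theorem markedConst_ne_top (C D : ℝ) (j : ℕ) : markedConst C D j ≠ ∞ := by
  induction j with
  | zero => simp [markedConst]
  | succ j ih =>
    exact ENNReal.mul_ne_top (ENNReal.add_ne_top.2 ⟨ih, ENNReal.ofReal_ne_top⟩)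
      (ENNReal.pow_ne_top ENNReal.ofReal_ne_top)

/-- Induction on the number `j` of ranks open to members transversal to `F`. With none left, `F`
itself marks every point. Each added member uses up its rank, costs one goodness estimate and one
covering, and triples the room needed around the ball. -/
theorem measure_not_isMarked_le {d : ℕ} {P : Type*} [Preorder P] {rk : P → ℕ}
    (hrk : StrictMono rk) {C D α ρ ε : ℝ} (hα : 0 < α) (hε : 0 < ε)
    {μ : Measure (EuclideanSpace ℝ (Fin d))} {U : Set (EuclideanSpace ℝ (Fin d))}
    (hfed : IsFederer D μ U) {ψ : P → EuclideanSpace ℝ (Fin d) → ℝ} (hψ : ∀ s x, 0 ≤ ψ s x)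
    (hcont : ∀ s, ContinuousOn (ψ s) U) (hgood : ∀ s, IsAbsGood C α μ U (ψ s)) (j : ℕ)
    (A : Finset ℕ) (hA : A.card = j) (F : Set P) (hF : IsChain (· < ·) F)
    (hFA : ∀ s ∈ transversal F, rk s ∈ A) (x : EuclideanSpace ℝ (Fin d)) (hx : x ∈ μ.support)
    (r : ℝ) (hr : 0 < r) (hU : Metric.ball x (3 ^ j * r) ⊆ U)
    (hsup : ∀ s ∈ transversal F, ENNReal.ofReal ρ ≤ supNormOn (ψ s) (Metric.ball x r)) :
    μ {y ∈ Metric.ball x r | ¬ IsMarked ψ ε ρ F y} ≤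
      markedConst C D j * (ENNReal.ofReal ε / ENNReal.ofReal ρ) ^ α * μ (Metric.ball x r) := by
  induction j generalizing A F x r with
  | zero =>
    have hempty : {y ∈ Metric.ball x r | ¬ IsMarked ψ ε ρ F y} = ∅ := by
      refine Set.eq_empty_of_forall_notMem fun y hy => hy.2 ⟨F, le_rfl, hF, by simp, fun s hs => ?_⟩
      have := hFA s hs
      simp [Finset.card_eq_zero.1 hA] at this
    rw [hempty, measure_empty]
    exact zero_le
  | succ j ih =>
    -- The Federer and goodness hypotheses only concern balls centred in the support, whose
    -- complement is null.
    set S := {y ∈ Metric.ball x r | ¬ IsMarked ψ ε ρ F y} ∩ μ.support with hSdef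
    have hp : (1 : ℝ) ≤ 3 ^ j := one_le_pow₀ (by norm_num)
    have h3U : Metric.ball x (3 * r) ⊆ U :=
      (Metric.ball_subset_ball (by rw [pow_succ]; nlinarith)).trans hU
    have hSball : S ⊆ Metric.ball x r := fun y hy => hy.1.1
    have hex : ∀ y ∈ S, ∃ t : ℝ, 0 < t ∧ t ≤ 2 * r ∧
        (∃ s ∈ transversal F, supNormOn (ψ s) (Metric.ball y (t / 3)) < ENNReal.ofReal ρ) ∧
        ∀ s ∈ transversal F, ENNReal.ofReal ρ ≤ supNormOn (ψ s) (Metric.ball y t) := by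
      intro y hy
      refine exists_radius ψ (hSball hy) _ hsup ?_
      -- If no transversal member were below `ρ` at `y`, then `F` itself would mark `y`.
      by_contra hcon
      push Not at hcon
      refine hy.1.2 ⟨F, le_rfl, hF, by simp, fun s hs => ?_⟩
      by_contra hlt
      refine hcon s hs (by rw [abs_of_nonneg (hψ s y)]; exact not_le.1 hlt)
        ((hcont s).continuousAt ?_)
      refine Filter.mem_of_superset (Metric.isOpen_ball.mem_nhds (hSball hy)) ?_
      exact (Metric.ball_subset_ball (by linarith)).trans h3U
    choose! t ht0 ht2 hts htl using hex
    have hS : μ S ≤ (markedConst C D j + ENNReal.ofReal C) *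
        (ENNReal.ofReal ε / ENNReal.ofReal ρ) ^ α * ENNReal.ofReal D ^ 4 *
          μ (Metric.ball x r) := by
      refine hfed.measure_le_of_local hx hr h3U hSball (fun y hy => hy.2) t ht0 ht2 _ ?_
      intro y hy
      obtain ⟨s, hs, hsmall⟩ := hts y hy
      have hyU : Metric.ball y (3 ^ j * t y) ⊆ U := by
        -- The centre moves by less than `r` and `t y ≤ 2 * r`, so the room needed is at most `3 ^ j
        -- * 2 * r + r ≤ 3 ^ (j + 1) * r`.
        refine (Metric.ball_subset_ball' ?_).trans hU
        have h1 := Metric.mem_ball.1 (hSball hy)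
        have h2 := ht2 y hy
        rw [pow_succ]
        nlinarith
      have hyU' : Metric.ball y (t y) ⊆ U :=
        (Metric.ball_subset_ball (by nlinarith [ht0 y hy])).trans hyU
      have hind := ih (A.erase (rk s)) (by rw [Finset.card_erase_of_mem (hFA s hs), hA]; rfl)
        (insert s F) (hF.insert fun b hb _ => hs b hb)
        (fun s' hs' => by
          refine Finset.mem_erase.2 ⟨?_, hFA s' (transversal_anti (Set.subset_insert _ _) hs')⟩
          exact (hs' s (Set.mem_insert _ _)).elim (fun h => (hrk h).ne) (fun h => (hrk h).ne'))
        y hy.2 (t y) (ht0 y hy) hyU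
        (fun s' hs' => htl y hy s' (transversal_anti (Set.subset_insert _ _) hs'))
      have hg : μ {z ∈ Metric.ball y (t y) | |ψ s z| < ε} ≤
          ENNReal.ofReal C * (ENNReal.ofReal ε / ENNReal.ofReal ρ) ^ α *
            μ (Metric.ball y (t y)) := by
        refine ((hgood s).2 y hy.2 (t y) (ht0 y hy) hyU' ε hε).trans ?_
        gcongr
        exact htl y hy s hs
      have hincl : S ∩ Metric.ball y (t y / 3) ⊆
          {z ∈ Metric.ball y (t y) | ¬ IsMarked ψ ε ρ (insert s F) z} ∪
            {z ∈ Metric.ball y (t y) | |ψ s z| < ε} := by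
        rintro z ⟨hz, hzb⟩
        have hzb' : z ∈ Metric.ball y (t y) :=
          Metric.ball_subset_ball (by linarith [ht0 y hy]) hzb
        by_contra hcon
        -- A point marked relative to `insert s F` with `ε ≤ ψ s z < ρ` is marked relative to `F`,
        -- contradicting `z ∈ S`.
        simp only [Set.mem_union, Set.mem_ofPred_eq, hzb', true_and, not_or, not_not,
          not_lt] at hcon
        have hlt := abs_lt_of_supNormOn_lt hsmall hzb
        rw [abs_of_nonneg (hψ s z)] at hcon hlt
        exact hz.1.2 (hcon.1.of_insert hcon.2 hlt.le)
      calc μ (S ∩ Metric.ball y (t y / 3)) ≤ _ := measure_mono hincl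
        _ ≤ _ := measure_union_le _ _
        _ ≤ _ := add_le_add hind hg
        _ = _ := by ring
    calc μ {y ∈ Metric.ball x r | ¬ IsMarked ψ ε ρ F y} ≤ μ (S ∪ μ.supportᶜ) :=
          measure_mono fun y hy => by
            by_cases h : y ∈ μ.support
            · exact Or.inl ⟨hy, h⟩
            · exact Or.inr h
      _ ≤ μ S + μ μ.supportᶜ := measure_union_le _ _
      _ = μ S := by rw [Measure.measure_compl_support, add_zero]
      _ ≤ _ := hS
      _ = _ := by rw [markedConst]; ring

/-! ### The flags of primitive collections -/

/-- Nonempty primitive collections in `ℤ^k`, preordered by their real spans. -/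
structure PrimitiveCollection (k : ℕ) where
  rank : ℕ
  rank_pos : 1 ≤ rank
  vec : Fin rank → Fin k → ℤ
  isPrimitive : IsPrimitiveCollection vec

namespace PrimitiveCollection

/-- The real span of a primitive collection. -/
noncomputable def span {k : ℕ} (p : PrimitiveCollection k) :
    Submodule ℝ (EuclideanSpace ℝ (Fin k)) := realSpan p.vec

noncomputable instance (k : ℕ) : Preorder (PrimitiveCollection k) := Preorder.lift span

theorem lt_iff_span_lt {k : ℕ} {p q : PrimitiveCollection k} : p < q ↔ p.span < q.span := Iff.rfl

theorem strictMono_rank (k : ℕ) : StrictMono (rank : PrimitiveCollection k → ℕ) := by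
  intro p q h
  have := Submodule.finrank_lt_finrank_of_lt (lt_iff_span_lt.1 h)
  rwa [span, span, p.isPrimitive.finrank_realSpan, q.isPrimitive.finrank_realSpan] at this

theorem rank_le {k : ℕ} (p : PrimitiveCollection k) : p.rank ≤ k := p.isPrimitive.le

end PrimitiveCollection

/-- A chain of primitive collections is split by an integer vector `w` into those whose span
contains `w` and those whose span lies in that of a single collection avoiding `w`. -/
theorem exists_split_of_isChain {k : ℕ} {G : Set (PrimitiveCollection k)}
    (hG : IsChain (· < ·) G) {f : PrimitiveCollection k → Prop} (hf : ∀ s ∈ G, f s)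
    {w : EuclideanSpace ℝ (Fin k)} (hw : w ≠ 0) :
    ∃ (r : ℕ) (v : Fin r → Fin k → ℤ),
      LinearIndependent ℝ (fun i => intEmb k (v i)) ∧ w ∉ realSpan v ∧
      (∀ t ∈ G, w ∈ t.span → realSpan v ≤ t.span) ∧
      (∀ t ∈ G, w ∉ t.span → t.span ≤ realSpan v) ∧
      (r = 0 ∨ ∃ s : PrimitiveCollection k, f s ∧ (⟨r, v⟩ : (r : ℕ) × (Fin r → Fin k → ℤ)) =
        ⟨s.rank, s.vec⟩) := by
  by_cases hne : ∃ s ∈ G, w ∉ s.span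
  -- Least corank: `s` is the largest member of the chain avoiding `w`. If there is none, the empty
  -- collection takes its place.
  · obtain ⟨s, ⟨hs, hws⟩, hmax⟩ := (InvImage.wf (fun s : PrimitiveCollection k => k - s.rank)
      wellFounded_lt).has_min {s | s ∈ G ∧ w ∉ s.span} hne
    refine ⟨s.rank, s.vec, s.isPrimitive.1, hws, fun t ht hwt => ?_, fun t ht hwt => ?_,
      Or.inr ⟨s, hf s hs, rfl⟩⟩
    · have hst : s ≠ t := fun h => hws (h ▸ hwt)
      rcases hG hs ht hst with h | h
      · exact (PrimitiveCollection.lt_iff_span_lt.1 h).le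
      · exact absurd ((PrimitiveCollection.lt_iff_span_lt.1 h).le hwt) hws
    · rcases eq_or_ne s t with rfl | hst
      · exact le_rfl
      · rcases hG hs ht hst with h | h
        · have h1 := PrimitiveCollection.strictMono_rank k h
          have h2 := t.rank_le
          exact absurd (show k - t.rank < k - s.rank by omega) (hmax t ⟨ht, hwt⟩)
        · exact (PrimitiveCollection.lt_iff_span_lt.1 h).le
  · push Not at hne
    have hbot : realSpan (fun i : Fin 0 => (i.elim0 : Fin k → ℤ)) = ⊥ := by
      simp [realSpan]
    refine ⟨0, fun i => i.elim0, linearIndependent_empty_type, ?_, fun t _ _ => ?_,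
      fun t ht h => absurd (hne t ht) h, Or.inl rfl⟩
    · rwa [hbot, Submodule.mem_bot]
    · rw [hbot]
      exact bot_le

/-- The span of `v` and `w` fits into the chain between the members avoiding `w` and those
containing it. Its covolume is therefore at least `ε` or at least `ρ`, while it is at most `‖h(x)
w‖` times that of `v`, which is at most `1`; this is where `ρ ≤ 1` enters. -/
theorem le_norm_of_isMarked {k : ℕ} {X : Type*} {h : X → Matrix.SpecialLinearGroup (Fin k) ℝ}
    {ε ρ : ℝ} (hερ : ε ≤ ρ) (hρ : ρ ≤ 1) {x : X}
    (hx : IsMarked (fun (s : PrimitiveCollection k) x => wedgeNorm (h x) s.vec) ε ρ ∅ x)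
    {w : Fin k → ℤ} (hw : w ≠ 0) : ε ≤ ‖act (h x) (intEmb k w)‖ := by
  obtain ⟨G, -, hG, hm, ht⟩ := hx
  have hw' : intEmb k w ≠ 0 := fun h0 => hw (intEmb_injective k (by rw [h0, map_zero]))
  obtain ⟨r, v, hv, hwv, hin, hout, hsmall⟩ := exists_split_of_isChain hG
    (f := fun s => wedgeNorm (h x) s.vec ≤ ρ) (fun s hs => (hm s ⟨hs, by simp⟩).2) hw'
  have hv1 : wedgeNorm (h x) v ≤ 1 := by
    rcases hsmall with rfl | ⟨s, hs, heq⟩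
    · exact (norm_ιMulti_zero _).le
    · obtain ⟨rfl, h2⟩ := Sigma.mk.inj_iff.1 heq
      rw [eq_of_heq h2]
      exact hs.trans hρ
  have key : ∀ p : PrimitiveCollection k,
      p.span = realSpan v ⊔ Submodule.span ℝ {intEmb k w} →
        wedgeNorm (h x) p.vec ≤ ‖act (h x) (intEmb k w)‖ := fun p hp =>
    (wedgeNorm_le_mul (h x) w hv p.isPrimitive hwv hp).trans
      (mul_le_of_le_one_right (norm_nonneg _) hv1)
  obtain ⟨m, u, hu, huspan⟩ := exists_primitive_of_span (Set.range v ∪ {w})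
  have huspan' : realSpan u = realSpan v ⊔ Submodule.span ℝ {intEmb k w} := by
    rw [huspan, Set.image_union, Submodule.span_union, Set.image_singleton, ← Set.range_comp]
    rfl
  have hwu : intEmb k w ∈ realSpan u := by
    rw [huspan']
    exact Submodule.mem_sup_right (Submodule.mem_span_singleton_self _)
  have hm1 : 1 ≤ m := by
    by_contra h0
    obtain rfl : m = 0 := by omega
    simp [realSpan, hw'] at hwu
  let p : PrimitiveCollection k := ⟨m, hm1, u, hu⟩
  by_cases hex : ∃ t ∈ G, t.span = p.span
  · obtain ⟨t, htG, hts⟩ := hex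
    exact (hm t ⟨htG, by simp⟩).1.trans (key t (hts.trans huspan'))
  · push Not at hex
    refine hερ.trans ((ht p fun t htG => ?_).trans (key p huspan'))
    by_cases hwt : intEmb k w ∈ t.span
    · refine Or.inl (PrimitiveCollection.lt_iff_span_lt.2 (lt_of_le_of_ne ?_ (hex t htG).symm))
      change realSpan u ≤ _
      rw [huspan']
      exact sup_le (hin t htG hwt) ((Submodule.span_singleton_le_iff_mem _ _).2 hwt)
    · refine Or.inr (PrimitiveCollection.lt_iff_span_lt.2 (lt_of_le_of_ne ?_ (hex t htG)))
      change _ ≤ realSpan u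
      rw [huspan']
      exact (hout t htG hwt).trans le_sup_left

theorem act_injective {k : ℕ} (g : Matrix.SpecialLinearGroup (Fin k) ℝ) :
    Function.Injective (act g) := by
  intro a b h
  have h1 : (g : Matrix (Fin k) (Fin k) ℝ).mulVec a.ofLp = (g : Matrix _ _ ℝ).mulVec b.ofLp :=
    congrArg WithLp.ofLp h
  have hu : IsUnit (g : Matrix (Fin k) (Fin k) ℝ) :=
    (Matrix.isUnit_iff_isUnit_det _).2 (by rw [g.det_coe]; exact isUnit_one)
  exact WithLp.ofLp_injective 2 (Matrix.mulVec_injective_of_isUnit hu h1)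

theorem latticeOf_mem_latticesK {k : ℕ} (hk : 0 < k) (g : Matrix.SpecialLinearGroup (Fin k) ℝ)
    {ε : ℝ} (h : ∀ w : Fin k → ℤ, w ≠ 0 → ε ≤ ‖act g (intEmb k w)‖) :
    latticeOf g ∈ latticesK k ε := by
  refine ⟨⟨g, rfl⟩, le_csInf ?_ ?_⟩
  -- The infimum of the empty set is `0` in `ℝ`, so a nonzero lattice vector must be exhibited.
  · have h1 : (fun _ => 1 : Fin k → ℤ) ≠ 0 := fun h0 => one_ne_zero (congrFun h0 ⟨0, hk⟩)
    refine ⟨_, act g (intEmb k fun _ => 1), ⟨⟨_, ⟨_, rfl⟩, rfl⟩, fun h0 => h1 ?_⟩, rfl⟩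
    exact intEmb_injective k (act_injective g (by rw [h0, map_zero, map_zero]))
  · rintro _ ⟨_, ⟨⟨_, ⟨w, rfl⟩, rfl⟩, hne⟩, rfl⟩
    refine h w fun h0 => hne ?_
    simp [h0]

end QuantNonDiv

/-! ### The nondivergence estimate -/

theorem mainTheorem7 (n d : ℕ) (hn : 1 ≤ n) (hd : 1 ≤ d) (C D α : ℝ)
    (hC : 0 < C) (hD : 0 < D) (hα : 0 < α) :
    ∃ C'' : ℝ, 0 < C'' ∧
      ∀ (ρ : ℝ), 0 < ρ → ρ ≤ 1 →
      ∀ (μ : Measure (EuclideanSpace ℝ (Fin d))) [IsLocallyFiniteMeasure μ],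
      ∀ x₀ ∈ μ.support, ∀ r₀ : ℝ, 0 < r₀ →
      QuantNonDiv.IsFederer D μ (Metric.ball x₀ (3 ^ (n + 1) * r₀)) →
      ∀ h : EuclideanSpace ℝ (Fin d) → Matrix.SpecialLinearGroup (Fin (n + 1)) ℝ,
      ContinuousOn h (Metric.ball x₀ (3 ^ (n + 1) * r₀)) →
      (∀ (r : ℕ), 1 ≤ r → ∀ v : Fin r → Fin (n + 1) → ℤ, QuantNonDiv.IsPrimitiveCollection v →
        QuantNonDiv.IsAbsGood C α μ (Metric.ball x₀ (3 ^ (n + 1) * r₀))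
            (fun x => QuantNonDiv.wedgeNorm (h x) v) ∧
          ENNReal.ofReal ρ ≤
            QuantNonDiv.supNormOn (fun x => QuantNonDiv.wedgeNorm (h x) v)
              (Metric.ball x₀ r₀)) →
      ∀ ε : ℝ, 0 < ε →
        μ {x ∈ Metric.ball x₀ r₀ |
            QuantNonDiv.latticeOf (h x) ∉ QuantNonDiv.latticesK (n + 1) ε} ≤
          ENNReal.ofReal (C'' * (ε / ρ) ^ α) * μ (Metric.ball x₀ r₀) := by
  -- The `1` makes the bound trivial when `ε > ρ`; otherwise the induction starts from the empty
  -- flag with the `n + 1` ranks `1, …, n + 1`.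
  refine ⟨max 1 (QuantNonDiv.markedConst C D (n + 1)).toReal, by positivity, ?_⟩
  intro ρ hρ hρ1 μ _ x₀ hx₀ r₀ hr₀ hfed h hh hyp ε hε
  set M := QuantNonDiv.markedConst C D (n + 1)
  rcases le_or_gt ε ρ with hερ | hερ
  · set ψ : QuantNonDiv.PrimitiveCollection (n + 1) → EuclideanSpace ℝ (Fin d) → ℝ :=
      fun s x => QuantNonDiv.wedgeNorm (h x) s.vec
    have hmain := QuantNonDiv.measure_not_isMarked_le (ψ := ψ) (ρ := ρ) (ε := ε)
      (QuantNonDiv.PrimitiveCollection.strictMono_rank (n + 1)) hα hε hfed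
      (fun s x => QuantNonDiv.wedgeNorm_nonneg _ _)
      (fun s => (QuantNonDiv.continuous_wedgeNorm s.vec).comp_continuousOn hh)
      (fun s => (hyp s.rank s.rank_pos s.vec s.isPrimitive).1) (n + 1)
      (Finset.Icc 1 (n + 1)) (by simp) ∅ IsChain.empty
      (fun s _ => Finset.mem_Icc.2 ⟨s.rank_pos, s.rank_le⟩) x₀ hx₀ r₀ hr₀ le_rfl
      (fun s _ => (hyp s.rank s.rank_pos s.vec s.isPrimitive).2)
    have hsub : {x ∈ Metric.ball x₀ r₀ |
        QuantNonDiv.latticeOf (h x) ∉ QuantNonDiv.latticesK (n + 1) ε} ⊆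
        {x ∈ Metric.ball x₀ r₀ | ¬ QuantNonDiv.IsMarked ψ ε ρ ∅ x} := fun x hx =>
      ⟨hx.1, fun hmark => hx.2 (QuantNonDiv.latticeOf_mem_latticesK n.succ_pos (h x)
        fun w hw => QuantNonDiv.le_norm_of_isMarked hερ hρ1 hmark hw)⟩
    refine (measure_mono hsub).trans (hmain.trans ?_)
    gcongr
    rw [← ENNReal.ofReal_div_of_pos hρ, ENNReal.ofReal_rpow_of_pos (by positivity),
      ENNReal.ofReal_mul (by positivity)]
    gcongr
    exact (ENNReal.le_ofReal_iff_toReal_le (QuantNonDiv.markedConst_ne_top C D _)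
      (by positivity)).2 (le_max_right _ _)
  · refine (measure_mono fun x hx => hx.1).trans (le_mul_of_one_le_left zero_le ?_)
    rw [ENNReal.one_le_ofReal]
    exact one_le_mul_of_one_le_of_one_le (le_max_left _ _)
      (Real.one_le_rpow ((one_le_div hρ).2 hερ.le) hα.le)
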